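/- Let $\mathbb K$ be a field of characteristic $0$, let $V$ be a vector space over $\mathbb K$ (of arbitrary dimension), and let $n,p\ge 1$ be integers. An $n$-Lie algebra (or $n$-Nambu-Lie algebra) $(V,\varphi)$ is the vector space $V$ together with a skew-symmetric $n$-linear map $\varphi:V^n\to V$ satisfying the fundamental identity $$\varphi\bigl(x_1,\dots,x_{n-1},\varphi(y_1,\dots,y_n)\bigr)=\sum_{k=1}^n\varphi\bigl(y_1,\dots,y_{k-1},\varphi(x_1,\dots,x_{n-1},y_k),y_{k+1},\dots,y_n\bigr)$$ for all $x_i,y_j\in V$. A $p$-form on $V$ is a skew-symmetric $p$-linear map $V^p\to\mathbb K$. For a $p$-form $\tau$ and a skew-symmetric $q$-linear map $\psi$ with values in $\mathbb K$ or in $V$, the skew-symmetric $(p+q)$-linear map $\tau\wedge\psi$ is defined by $$(\tau\wedge\psi)(x_1,\dots,x_{p+q})=\frac1{q!\,p!}\sum_{\sigma\in S_{p+q}}\operatorname{sgn}(\sigma)\,\tau(x_{\sigma(1)},\dots,x_{\sigma(p)})\,\psi(x_{\sigma(p+1)},\dots,x_{\sigma(p+q)}),$$ and $i_{x_1\cdots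 x_{p-1}}\tau$ denotes the $1$-form $\tau(x_1,\dots,x_{p-1},\cdot)$. **Proposition 6.5.** Let $(V,\varphi)$ be an $n$-Lie algebra and let $\tau$ be a $p$-form on $V$ such that $$\tau\bigl(\varphi(x_1,\dots,x_n),y_1,\dots,y_{p-1}\bigr)=0\quad\text{for all }x_1,\dots,x_n,y_1,\dots,y_{p-1}\in V,$$ and $$(i_{x_1\cdots x_{p-1}}\tau)\wedge\tau=0\quad\text{for all }x_1,\dots,x_{p-1}\in V.$$ Then $(V,\tau\wedge\varphi)$ is an $(n+p)$-Lie algebra; that is, the skew-symmetric $(n+p)$-linear map $\tau\wedge\varphi:V^{n+p}\to V$ satisfies the fundamental identity. -/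

import Mathlib

namespace NambuLie

variable {K V N : Type*} [Field K] [AddCommGroup V] [Module K V] [AddCommGroup N] [Module K N]

/-- The multilinear map
`(x₁, …, x_{p+q}) ↦ τ(x₁, …, x_p) • ψ(x_{p+1}, …, x_{p+q})`. -/
def outerProduct {p q : ℕ} (τ : V [⋀^Fin p]→ₗ[K] K) (ψ : V [⋀^Fin q]→ₗ[K] N) :
    MultilinearMap K (fun _ : Fin (p + q) => V) N :=
  ((TensorProduct.lift (LinearMap.lsmul K N)).compMultilinearMap
    (τ.toMultilinearMap.domCoprod ψ.toMultilinearMap)).domDomCongr finSumFinEquiv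

theorem outerProduct_apply {p q : ℕ} (τ : V [⋀^Fin p]→ₗ[K] K) (ψ : V [⋀^Fin q]→ₗ[K] N)
    (x : Fin (p + q) → V) :
    outerProduct τ ψ x
      = τ (fun i => x (Fin.castAdd q i)) • ψ (fun j => x (Fin.natAdd p j)) := by
  simp [outerProduct, MultilinearMap.domCoprod_apply]

/-- The wedge product of a `p`-form `τ` with an alternating `q`-linear map `ψ` (scalar or vector
valued); see `wedge_apply` for the explicit formula. -/
noncomputable def wedge {p q : ℕ} (τ : V [⋀^Fin p]→ₗ[K] K) (ψ : V [⋀^Fin q]→ₗ[K] N) :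
    V [⋀^Fin (p + q)]→ₗ[K] N :=
  ((q.factorial : K) * (p.factorial : K))⁻¹ •
    MultilinearMap.alternatization (outerProduct τ ψ)

theorem wedge_apply {p q : ℕ} (τ : V [⋀^Fin p]→ₗ[K] K) (ψ : V [⋀^Fin q]→ₗ[K] N)
    (x : Fin (p + q) → V) :
    wedge τ ψ x = ((q.factorial : K) * (p.factorial : K))⁻¹ •
      ∑ σ : Equiv.Perm (Fin (p + q)), Equiv.Perm.sign σ •
        (τ (fun i => x (σ (Fin.castAdd q i))) • ψ (fun j => x (σ (Fin.natAdd p j)))) := by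
  simp [wedge, MultilinearMap.alternatization_apply, outerProduct_apply]

/-- The `1`-form `i_{x₁⋯x_p} τ = τ(x₁, …, x_p, ·)` obtained from a `(p+1)`-form `τ`. -/
def contract {p : ℕ} (x : Fin p → V) (τ : V [⋀^Fin (p + 1)]→ₗ[K] K) : V [⋀^Fin 1]→ₗ[K] K :=
  AlternatingMap.ofSubsingleton K V K (0 : Fin 1)
    (τ.toMultilinearMap.toLinearMap (Fin.snoc x (0 : V) : Fin (p + 1) → V) (Fin.last p))

theorem contract_apply {p : ℕ} (x : Fin p → V) (τ : V [⋀^Fin (p + 1)]→ₗ[K] K) (v : Fin 1 → V) :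
    contract x τ v = τ (Fin.snoc x (v 0) : Fin (p + 1) → V) := by
  simp [contract, Fin.update_snoc_last]

/-- An alternating `(n+1)`-linear bracket `φ` on `V` makes `(V, φ)` an `(n+1)`-Lie algebra
(also called `(n+1)`-Nambu-Lie algebra): it satisfies the fundamental identity
`[x₁, …, x_n, [y₁, …, y_{n+1}]] = ∑ₖ [y₁, …, y_{k-1}, [x₁, …, x_n, yₖ], y_{k+1}, …, y_{n+1}]`.
The arity is written as `n + 1` since it has to be positive. -/
def IsNLieBracket {n : ℕ} (φ : V [⋀^Fin (n + 1)]→ₗ[K] V) : Prop :=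
  ∀ (x : Fin n → V) (y : Fin (n + 1) → V),
    φ (Fin.snoc x (φ y) : Fin (n + 1) → V)
      = ∑ k : Fin (n + 1),
          φ (Function.update y k (φ (Fin.snoc x (y k) : Fin (n + 1) → V)))

/-- The `(p+1)`-form `τ` is `φ`-compatible: `τ(φ(x₁, …, x_n), y₁, …, y_p) = 0` for all
`x₁, …, x_n, y₁, …, y_p`. -/
def IsCompatible {n p : ℕ} (φ : V [⋀^Fin n]→ₗ[K] V) (τ : V [⋀^Fin (p + 1)]→ₗ[K] K) : Prop :=
  ∀ (x : Fin n → V) (y : Fin p → V), τ (Fin.cons (φ x) y : Fin (p + 1) → V) = 0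

end NambuLie

namespace NambuLie

variable {K V N : Type*} [Field K] [AddCommGroup V] [Module K V] [AddCommGroup N] [Module K N]

open Equiv Function

/-! The fundamental identity says that each `ad φ x` is a derivation of the bracket, and
`derivationDefect` is linear in the endomorphism. Expanding `ad (wedge τ φ) x` over permutations,
each summand is of one of two kinds, according to where the free argument lands.

In a slot of `φ`, it gives a multiple of some `ad φ x'`, a derivation of `φ` whose values `τ`
annihilates; the Leibniz rule `derivationDefect_wedge` makes it a derivation of `τ ∧ φ`.

In a slot of `τ`, it gives a multiple of `v ↦ α v • φ z` with `α` a contraction of `τ`.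
Compatibility gives `α (φ y) = 0`, so only terms pairing `τ` with `α` survive, and
`sum_sign_smul_update_eq_zero` kills them using `α ∧ τ = 0`. -/

/-- Moving a slot of an alternating map into another position costs only a sign. -/
theorem exists_map_update_eq_smul_map_update {n : ℕ} (φ : V [⋀^Fin n]→ₗ[K] N)
    (u : Fin n → V) (i j : Fin n) :
    ∃ (s : K) (x : Fin n → V), ∀ v : V, φ (update u i v) = s • φ (update x j v) := by
  refine ⟨((Perm.sign (swap i j) : ℤˣ) : ℤ), u ∘ swap i j, fun v => ?_⟩
  rw [Int.cast_smul_eq_zsmul, ← Units.smul_def, ← φ.map_perm]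
  congr 1
  funext k
  simp only [update_apply, comp_apply, swap_apply_self]
  congr 1
  rw [swap_apply_eq_iff, swap_apply_right]

theorem update_last_eq_snoc {A : Type*} {n : ℕ} (u : Fin (n + 1) → A) (v : A) :
    update u (Fin.last n) v = Fin.snoc (Fin.init u) v := by
  conv_lhs => rw [← Fin.snoc_init_self u, Fin.update_snoc_last]

theorem IsCompatible.map_update_eq_zero {n p : ℕ} {φ : V [⋀^Fin n]→ₗ[K] V}
    {τ : V [⋀^Fin (p + 1)]→ₗ[K] K} (h : IsCompatible φ τ) (u : Fin (p + 1) → V)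
    (i : Fin (p + 1)) (x : Fin n → V) : τ (update u i (φ x)) = 0 := by
  obtain ⟨s, u', hs⟩ := exists_map_update_eq_smul_map_update τ u i 0
  rw [hs, ← Fin.cons_self_tail u', Fin.update_cons_zero, h, smul_zero]

/-- If `α ∧ τ = 0` for a `1`-form `α`, then every antisymmetrised product in which `α` and `τ`
occur as factors in separate arguments vanishes. -/
theorem sum_sign_smul_update_eq_zero [CharZero K] {p q : ℕ} {α : V [⋀^Fin 1]→ₗ[K] K}
    {τ : V [⋀^Fin p]→ₗ[K] K} (h : wedge α τ = 0) (φ : V [⋀^Fin q]→ₗ[K] N) (w : V) (j : Fin q)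
    (y : Fin (p + q) → V) :
    ∑ σ : Perm (Fin (p + q)), Perm.sign σ •
      (τ (fun i => y (σ (Fin.castAdd q i))) • (α (fun _ => y (σ (Fin.natAdd p j))) •
        φ (update (fun k => y (σ (Fin.natAdd p k))) j w))) = 0 := by
  have hsum (z : Fin (1 + p) → V) : ∑ ρ : Perm (Fin (1 + p)), Perm.sign ρ •
      (α (fun i => z (ρ (Fin.castAdd p i))) * τ (fun i => z (ρ (Fin.natAdd 1 i)))) = 0 := by
    have hz := congrArg (fun f => f z) h
    simp only [wedge_apply, AlternatingMap.zero_apply, smul_eq_mul] at hz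
    refine (mul_eq_zero.mp hz).resolve_left (inv_ne_zero (mul_ne_zero ?_ ?_)) <;>
      exact_mod_cast Nat.factorial_ne_zero _
  -- The positions read by `α` and `τ`. Since `w` occupies slot `j` of `φ`, permuting these
  -- positions leaves the `φ` factor unchanged, so the sum over each coset of this subgroup contains
  -- `α ∧ τ` as a factor.
  let f : Fin (1 + p) → Fin (p + q) := Fin.append (fun _ => Fin.natAdd p j) (Fin.castAdd q)
  have hf0 (i) : f (Fin.castAdd p i) = Fin.natAdd p j := Fin.append_left _ _ i
  have hf1 (i) : f (Fin.natAdd 1 i) = Fin.castAdd q i := Fin.append_right _ _ i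
  have hf : Injective f := by
    intro a b
    induction a using Fin.addCases <;> induction b using Fin.addCases <;>
      simp only [hf0, hf1, Fin.ext_iff, Fin.val_castAdd, Fin.val_natAdd] <;> omega
  let ι : Fin (1 + p) ↪ Fin (p + q) := ⟨f, hf⟩
  have hι (ρ : Perm (Fin (1 + p))) (a) : ρ.viaEmbedding ι (f a) = f (ρ a) :=
    ρ.viaEmbedding_apply ι a
  have hfix (ρ : Perm (Fin (1 + p))) {k : Fin q} (hk : k ≠ j) :
      ρ.viaEmbedding ι (Fin.natAdd p k) = Fin.natAdd p k := by
    refine ρ.viaEmbedding_apply_of_notMem ι _ ?_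
    rintro ⟨a, ha⟩
    change f a = _ at ha
    induction a using Fin.addCases with
    | left i =>
      rw [hf0, Fin.ext_iff] at ha
      exact hk (Fin.ext (by simpa using ha.symm))
    | right i =>
      rw [hf1, Fin.ext_iff] at ha
      simp only [Fin.val_castAdd, Fin.val_natAdd] at ha
      omega
  set F : Perm (Fin (p + q)) → N := fun σ => Perm.sign σ •
      (τ (fun i => y (σ (Fin.castAdd q i))) • (α (fun _ => y (σ (Fin.natAdd p j))) •
        φ (update (fun k => y (σ (Fin.natAdd p k))) j w))) with hF
  have hinner (σ : Perm (Fin (p + q))) :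
      ∑ ρ : Perm (Fin (1 + p)), F (σ * ρ.viaEmbedding ι) = 0 := by
    have hterm (ρ : Perm (Fin (1 + p))) : F (σ * ρ.viaEmbedding ι) =
        (Perm.sign ρ • (α (fun i => (y ∘ σ ∘ f) (ρ (Fin.castAdd p i))) *
          τ (fun i => (y ∘ σ ∘ f) (ρ (Fin.natAdd 1 i))))) •
          (Perm.sign σ • φ (update (fun k => y (σ (Fin.natAdd p k))) j w)) := by
      have hu : update (fun k => y ((σ * ρ.viaEmbedding ι) (Fin.natAdd p k))) j w
          = update (fun k => y (σ (Fin.natAdd p k))) j w := by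
        funext k
        by_cases hk : k = j
        · subst hk; simp
        · simp [hk, hfix ρ hk]
      have ht : (fun i => y ((σ * ρ.viaEmbedding ι) (Fin.castAdd q i)))
          = fun i => (y ∘ σ ∘ f) (ρ (Fin.natAdd 1 i)) := by
        funext i
        simp [← hf1, hι]
      have ha : (fun _ : Fin 1 => y ((σ * ρ.viaEmbedding ι) (Fin.natAdd p j)))
          = fun i => (y ∘ σ ∘ f) (ρ (Fin.castAdd p i)) := by
        funext i
        rw [← hf0 i]
        simp [hι]
      have hs : Perm.sign (ρ.viaEmbedding ι) = Perm.sign ρ := by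
        simp only [Perm.viaEmbedding, Perm.sign_extendDomain]
      simp only [hF, hu, ht, ha, Perm.sign_mul, hs]
      simp only [Units.smul_def, ← Int.cast_smul_eq_zsmul K, smul_smul, smul_eq_mul]
      congr 1
      push_cast
      ring
    simp only [hterm, ← Finset.sum_smul, hsum, zero_smul]
  -- Each right translation preserves the full sum; adding them all counts it `(1 + p)!` times,
  -- which is invertible in characteristic zero.
  have hcard : ((Fintype.card (Perm (Fin (1 + p))) : ℕ) : K) • ∑ σ, F σ = 0 := by
    calc _ = ∑ ρ : Perm (Fin (1 + p)), ∑ σ, F σ := by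
          rw [Finset.sum_const, Finset.card_univ, Nat.cast_smul_eq_nsmul]
      _ = ∑ ρ : Perm (Fin (1 + p)), ∑ σ, F (σ * ρ.viaEmbedding ι) :=
          Finset.sum_congr rfl fun ρ _ =>
            (Equiv.sum_comp (Equiv.mulRight (ρ.viaEmbedding ι)) F).symm
      _ = 0 := by
          rw [Finset.sum_comm]
          exact Finset.sum_eq_zero fun σ _ => hinner σ
  exact (smul_eq_zero.mp hcard).resolve_left (Nat.cast_ne_zero.mpr Fintype.card_ne_zero)

/-- The failure of an endomorphism `L` to be a derivation of `φ`, at the arguments `y`. -/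
def derivationDefect {n : ℕ} (φ : V [⋀^Fin n]→ₗ[K] V) (y : Fin n → V) :
    (V →ₗ[K] V) →ₗ[K] V :=
  LinearMap.applyₗ (φ y) -
    ∑ k, φ.toMultilinearMap.toLinearMap y k ∘ₗ LinearMap.applyₗ (y k)

theorem derivationDefect_apply {n : ℕ} (φ : V [⋀^Fin n]→ₗ[K] V) (y : Fin n → V)
    (L : V →ₗ[K] V) :
    derivationDefect φ y L = L (φ y) - ∑ k, φ (update y k (L (y k))) := by
  simp [derivationDefect]

/-- The endomorphism `φ(x₁, …, x_n, ·)`. -/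
def ad {n : ℕ} (φ : V [⋀^Fin (n + 1)]→ₗ[K] V) (x : Fin n → V) : V →ₗ[K] V :=
  φ.toMultilinearMap.toLinearMap (Fin.snoc x (0 : V) : Fin (n + 1) → V) (Fin.last n)

theorem ad_apply {n : ℕ} (φ : V [⋀^Fin (n + 1)]→ₗ[K] V) (x : Fin n → V) (v : V) :
    ad φ x v = φ (Fin.snoc x v : Fin (n + 1) → V) := by
  simp [ad, Fin.update_snoc_last]

theorem isNLieBracket_iff_derivationDefect_ad_eq_zero {n : ℕ} (φ : V [⋀^Fin (n + 1)]→ₗ[K] V) :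
    IsNLieBracket φ ↔ ∀ x y, derivationDefect φ y (ad φ x) = 0 := by
  simp only [IsNLieBracket, derivationDefect_apply, ad_apply, sub_eq_zero]

/-- The Leibniz rule: an endomorphism `L` whose values are annihilated by `τ` acts on `τ ∧ φ`
through its action on `φ`. -/
theorem derivationDefect_wedge {p q : ℕ} (τ : V [⋀^Fin p]→ₗ[K] K) (φ : V [⋀^Fin q]→ₗ[K] V)
    (L : V →ₗ[K] V) (hL : ∀ u i v, τ (update u i (L v)) = 0) (y : Fin (p + q) → V) :
    derivationDefect (wedge τ φ) y L = ((q.factorial : K) * (p.factorial : K))⁻¹ •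
      ∑ σ : Perm (Fin (p + q)), Perm.sign σ • (τ (fun i => y (σ (Fin.castAdd q i))) •
        derivationDefect φ (fun k => y (σ (Fin.natAdd p k))) L) := by
  have hσ (σ : Perm (Fin (p + q))) :
      ∑ k, τ (fun i => update y k (L (y k)) (σ (Fin.castAdd q i))) •
          φ (fun j => update y k (L (y k)) (σ (Fin.natAdd p j))) =
        τ (fun i => y (σ (Fin.castAdd q i))) •
          ∑ j, φ (update (fun k => y (σ (Fin.natAdd p k))) j (L (y (σ (Fin.natAdd p j))))) := by
    -- Indexing the modified argument by its position after `σ` separates the slots of `τ`, whose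
    -- terms vanish by `hL`, from those of `φ`.
    rw [← Equiv.sum_comp σ, Fin.sum_univ_add, Finset.smul_sum]
    have hleft (i : Fin p) (v : V) : (fun i' => update y (σ (Fin.castAdd q i)) v
        (σ (Fin.castAdd q i'))) = update (fun i => y (σ (Fin.castAdd q i))) i v := by
      funext i'
      simp [update_apply]
    have hright (j : Fin q) (v : V) : (fun j' => update y (σ (Fin.natAdd p j)) v
        (σ (Fin.natAdd p j'))) = update (fun j => y (σ (Fin.natAdd p j))) j v := by
      funext j'
      simp [update_apply]
    have hmixed (j : Fin q) (v : V) : (fun i => update y (σ (Fin.natAdd p j)) v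
        (σ (Fin.castAdd q i))) = fun i => y (σ (Fin.castAdd q i)) := by
      funext i
      refine update_of_ne (fun h => ?_) _ _
      have := congrArg Fin.val (σ.injective h)
      simp only [Fin.val_castAdd, Fin.val_natAdd] at this
      omega
    simp only [hleft, hright, hmixed, hL, zero_smul, Finset.sum_const_zero, zero_add]
  simp only [derivationDefect_apply, wedge_apply, map_smul, map_sum, ← Finset.smul_sum, ← smul_sub,
    Units.smul_def, map_zsmul]
  rw [Finset.sum_comm, ← Finset.sum_sub_distrib]
  simp only [← Finset.smul_sum, hσ, smul_sub]

/-- If `φ` is a bracket and `τ` is compatible with it, the endomorphisms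
`c • φ(x₁, …, x_n, ·)` are derivations of `τ ∧ φ`. -/
theorem derivationDefect_wedge_smul_ad {n p : ℕ} {φ : V [⋀^Fin (n + 1)]→ₗ[K] V}
    {τ : V [⋀^Fin (p + 1)]→ₗ[K] K} (hφ : IsNLieBracket φ) (hτφ : IsCompatible φ τ) (c : K)
    (x : Fin n → V) (y : Fin ((p + 1) + (n + 1)) → V) :
    derivationDefect (wedge τ φ) y (c • ad φ x) = 0 := by
  rw [map_smul, derivationDefect_wedge]
  · simp [(isNLieBracket_iff_derivationDefect_ad_eq_zero φ).mp hφ]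
  · intro u i v
    rw [ad_apply, hτφ.map_update_eq_zero]

/-- If `α ∧ τ = 0` and both forms annihilate the values of `φ`, the endomorphism
`v ↦ α v • φ z` is a derivation of `τ ∧ φ`. -/
theorem derivationDefect_wedge_smulRight [CharZero K] {p q : ℕ} {φ : V [⋀^Fin q]→ₗ[K] V}
    {τ : V [⋀^Fin (p + 1)]→ₗ[K] K} (hτφ : IsCompatible φ τ) {α : V [⋀^Fin 1]→ₗ[K] K}
    (hα : wedge α τ = 0) (hαφ : ∀ x, α (fun _ => φ x) = 0) (L : V →ₗ[K] V) (z : Fin q → V)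
    (hL : ∀ v, L v = α (fun _ => v) • φ z) (y : Fin ((p + 1) + q) → V) :
    derivationDefect (wedge τ φ) y L = 0 := by
  rw [derivationDefect_wedge]
  -- The term `L (φ _)` vanishes by `hαφ`; what remains has `φ z` in slot `j` of `φ`, with
  -- coefficient `α` of the displaced argument.
  · simp only [derivationDefect_apply, hL, hαφ, zero_smul, zero_sub, smul_neg,
      AlternatingMap.map_update_smul, Finset.smul_sum, Finset.sum_neg_distrib]
    rw [Finset.sum_comm, neg_eq_zero]
    refine Finset.sum_eq_zero fun j _ => ?_
    rw [← Finset.smul_sum, sum_sign_smul_update_eq_zero hα, smul_zero]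
  · intro u i v
    rw [hL, AlternatingMap.map_update_smul, hτφ.map_update_eq_zero, smul_zero]

theorem isNLieBracket_wedge [CharZero K] {n p : ℕ} {φ : V [⋀^Fin (n + 1)]→ₗ[K] V}
    {τ : V [⋀^Fin (p + 1)]→ₗ[K] K} (hφ : IsNLieBracket φ) (hτφ : IsCompatible φ τ)
    (hτ : ∀ x : Fin p → V, wedge (contract x τ) τ = 0) :
    IsNLieBracket (n := p + 1 + n)
      (wedge τ φ : V [⋀^Fin ((p + 1) + (n + 1))]→ₗ[K] V) := by
  rw [isNLieBracket_iff_derivationDefect_ad_eq_zero]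
  intro x y
  let z (v : V) : Fin ((p + 1) + (n + 1)) → V := (Fin.snoc x v : Fin (p + 1 + n + 1) → V)
  -- The last entry of `z₀` is immaterial, as it is always overwritten by `v`.
  obtain ⟨z₀, hz⟩ : ∃ z₀, ∀ v, z v = update z₀ (Fin.last (p + 1 + n)) v :=
    ⟨z 0, fun v => (Fin.update_snoc_last (α := fun _ => V) _ _ _).symm⟩
  have hsummand (σ : Perm (Fin ((p + 1) + (n + 1)))) : ∃ L : V →ₗ[K] V,
      (∀ v, L v = τ (fun i => z v (σ (Fin.castAdd (n + 1) i))) •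
        φ (fun j => z v (σ (Fin.natAdd (p + 1) j)))) ∧
      derivationDefect (wedge τ φ) y L = 0 := by
    -- `m` is the slot of the outer product that receives the free argument `v`.
    obtain ⟨m, hm⟩ := σ.surjective (Fin.last (p + 1 + n))
    simp only [hz, ← hm]
    clear hm
    induction m using Fin.addCases with
    | left i =>
      have h1 (v : V) : (fun i' => update z₀ (σ (Fin.castAdd (n + 1) i)) v
          (σ (Fin.castAdd (n + 1) i'))) =
          update (fun i => z₀ (σ (Fin.castAdd (n + 1) i))) i v := by
        funext i'
        simp [update_apply]
      have h2 (v : V) : (fun j => update z₀ (σ (Fin.castAdd (n + 1) i)) v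
          (σ (Fin.natAdd (p + 1) j))) = fun j => z₀ (σ (Fin.natAdd (p + 1) j)) := by
        funext j
        refine update_of_ne (fun h => ?_) _ _
        have := congrArg Fin.val (σ.injective h)
        simp only [Fin.val_castAdd, Fin.val_natAdd] at this
        omega
      -- `contract` frees the last slot of `τ`, so `v` is moved there at the cost of the sign `s`.
      obtain ⟨s, u, hs⟩ := exists_map_update_eq_smul_map_update τ
        (fun i => z₀ (σ (Fin.castAdd (n + 1) i))) i (Fin.last p)
      have hL (v : V) : (τ.toMultilinearMap.toLinearMap u (Fin.last p)).smulRight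
          (φ fun j => z₀ (σ (Fin.natAdd (p + 1) j))) v =
          contract (Fin.init u) τ (fun _ => v) • φ fun j => z₀ (σ (Fin.natAdd (p + 1) j)) := by
        simp [contract_apply, ← update_last_eq_snoc]
      refine ⟨s • (τ.toMultilinearMap.toLinearMap u (Fin.last p)).smulRight
        (φ fun j => z₀ (σ (Fin.natAdd (p + 1) j))), fun v => ?_, ?_⟩
      · rw [h1, h2, hs]
        simp [mul_smul]
      · rw [map_smul, derivationDefect_wedge_smulRight hτφ (hτ (Fin.init u)) _ _ _ hL, smul_zero]
        intro t
        rw [contract_apply, ← update_last_eq_snoc, hτφ.map_update_eq_zero]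
    | right j =>
      have h1 (v : V) : (fun j' => update z₀ (σ (Fin.natAdd (p + 1) j)) v
          (σ (Fin.natAdd (p + 1) j'))) =
          update (fun j => z₀ (σ (Fin.natAdd (p + 1) j))) j v := by
        funext j'
        simp [update_apply]
      have h2 (v : V) : (fun i => update z₀ (σ (Fin.natAdd (p + 1) j)) v
          (σ (Fin.castAdd (n + 1) i))) = fun i => z₀ (σ (Fin.castAdd (n + 1) i)) := by
        funext i
        refine update_of_ne (fun h => ?_) _ _
        have := congrArg Fin.val (σ.injective h)
        simp only [Fin.val_castAdd, Fin.val_natAdd] at this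
        omega
      obtain ⟨s, u, hs⟩ := exists_map_update_eq_smul_map_update φ
        (fun j => z₀ (σ (Fin.natAdd (p + 1) j))) j (Fin.last n)
      refine ⟨(τ (fun i => z₀ (σ (Fin.castAdd (n + 1) i))) * s) • ad φ (Fin.init u),
        fun v => ?_, derivationDefect_wedge_smul_ad hφ hτφ _ _ _⟩
      rw [h1, h2, hs, LinearMap.smul_apply, ad_apply, update_last_eq_snoc, mul_smul]
  choose L hL hL0 using hsummand
  have had : ad (n := p + 1 + n) (wedge τ φ : V [⋀^Fin ((p + 1) + (n + 1))]→ₗ[K] V) x =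
      (((n + 1).factorial : K) * ((p + 1).factorial : K))⁻¹ • ∑ σ, Perm.sign σ • L σ := by
    ext v
    rw [ad_apply]
    refine (wedge_apply τ φ (z v)).trans ?_
    simp only [LinearMap.smul_apply, LinearMap.sum_apply, Units.smul_def, hL]
  rw [had, map_smul, map_sum]
  simp only [Units.smul_def, map_zsmul]
  rw [Finset.sum_eq_zero, smul_zero]
  intro σ _
  exact (congrArg _ (hL0 σ)).trans (smul_zero _)

end NambuLie

theorem proposition6p5 {K V : Type*} [Field K] [CharZero K] [AddCommGroup V] [Module K V]
    {n p : ℕ} (φ : V [⋀^Fin (n + 1)]→ₗ[K] V) (τ : V [⋀^Fin (p + 1)]→ₗ[K] K)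
    (hφ : NambuLie.IsNLieBracket φ)
    (hτφ : NambuLie.IsCompatible φ τ)
    (hτ : ∀ x : Fin p → V, NambuLie.wedge (NambuLie.contract x τ) τ = 0) :
    NambuLie.IsNLieBracket (n := p + 1 + n) 
      (NambuLie.wedge τ φ : V [⋀^Fin ((p + 1) + (n + 1))]→ₗ[K] V) := by
  exact NambuLie.isNLieBracket_wedge hφ hτφ hτ
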